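/- There is an integer $k_0$ such that the following holds for all $k \geq k_0$. Let $A = (a_{ij})$ be a random real symmetric $k \times k$ matrix with $a_{ii} = 0$ for all $i$, whose entries $a_{ij}$ with $i < j$ are independent random variables, each taking the values $1$ and $-1$ with probability $1/2$. Let $\lambda_1(A) \geq \lambda_2(A) \geq \dots \geq \lambda_k(A)$ be the eigenvalues of $A$. Then for all real $t \geq 0$, $$\Pr\Big[\max_{1 \leq i \leq k} |\lambda_i(A)| \geq 3\sqrt{k} + t\Big] \leq 4 e^{-t^2/32}.$$ -/

import Mathlib

/-- `A` is a random symmetric `k × k` matrix (defined on the probability space `(Ω, μ)`) with zero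
diagonal, whose entries above the diagonal are independent symmetric Bernoulli random variables,
i.e. take each of the values `1` and `-1` with probability `1 / 2`. -/
structure IsSymmetricBernoulliMatrix {Ω : Type*} [MeasurableSpace Ω]
    (μ : MeasureTheory.Measure Ω) {k : ℕ} (A : Ω → Matrix (Fin k) (Fin k) ℝ) : Prop where
  isSymm : ∀ ω, (A ω).IsSymm
  diag_eq_zero : ∀ ω i, A ω i i = 0
  measurable_entry : ∀ i j, i < j → Measurable (fun ω => A ω i j)
  prob_one : ∀ i j, i < j → μ {ω | A ω i j = 1} = 1 / 2
  prob_neg_one : ∀ i j, i < j → μ {ω | A ω i j = -1} = 1 / 2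
  indep : ProbabilityTheory.iIndepFun
    (fun (p : {p : Fin k × Fin k // p.1 < p.2}) (ω : Ω) => A ω p.1.1 p.1.2) μ

theorem IsSymmetricBernoulliMatrix.isHermitian {Ω : Type*} [MeasurableSpace Ω]
    {μ : MeasureTheory.Measure Ω} {k : ℕ} {A : Ω → Matrix (Fin k) (Fin k) ℝ}
    (hA : IsSymmetricBernoulliMatrix μ A) (ω : Ω) : (A ω).IsHermitian := by
  rw [Matrix.IsHermitian, Matrix.conjTranspose_eq_transpose_of_trivial]
  exact hA.isSymm ω

open MeasureTheory ProbabilityTheory Metric Real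

/-! A first moment argument replaces a net on the sphere. Let Z be the integral of exp(b⟨u, Au⟩ -
b²‖u‖⁴) over the ball of radius a + r. For each fixed u the integrand has mean at most 1
(`lintegral_exp_quadForm_le`), so E Z is at most the volume of that ball.

Conversely, let v be a unit eigenvector with eigenvalue λ. By Jensen on the ball of radius r about
av, Z ≥ exp(ba²λ - b²(1 + 4a²r²)) vol B(r): terms linear in the displacement average to 0 by
oddness, and ⟨x, Ax⟩ averages to 0 because A has zero diagonal.

Markov's inequality bounds the tail of each sign of the spectrum at the entropy cost ((a + r)/r)^k.
Optimising b and taking a = 40/41, r = 9/41 makes 3√k absorb this cost. -/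

/-- The value at `u` of the quadratic form of the matrix `A`. -/
def quadForm {k : ℕ} (A : Matrix (Fin k) (Fin k) ℝ) (u : EuclideanSpace ℝ (Fin k)) : ℝ :=
  ∑ i, ∑ j, A i j * (u i * u j)

theorem sum_sum_eq_diag_add_two_mul_upper {k : ℕ} (g : Fin k → Fin k → ℝ)
    (hg : ∀ i j, g i j = g j i) :
    ∑ i, ∑ j, g i j
      = ∑ i, g i i + 2 * ∑ p : {p : Fin k × Fin k // p.1 < p.2}, g p.1.1 p.1.2 := by
  have hupper : ∑ p : {p : Fin k × Fin k // p.1 < p.2}, g p.1.1 p.1.2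
      = ∑ i, ∑ j, if i < j then g i j else 0 := by
    rw [← Fintype.sum_prod_type' (f := fun i j => if i < j then g i j else 0),
      ← Finset.sum_filter]
    exact (Finset.sum_subtype _ (by simp) fun p : Fin k × Fin k => g p.1 p.2).symm
  have hdiag : ∑ i, g i i = ∑ i, ∑ j, if i = j then g i j else 0 := by simp
  have hlower : ∑ i, ∑ j, (if i < j then g i j else 0)
      = ∑ i, ∑ j, if j < i then g i j else 0 := by
    rw [Finset.sum_comm]
    exact Finset.sum_congr rfl fun i _ => Finset.sum_congr rfl fun j _ => by rw [hg]
  rw [two_mul, hupper]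
  nth_rewrite 2 [hlower]
  rw [hdiag, ← Finset.sum_add_distrib, ← Finset.sum_add_distrib]
  refine Finset.sum_congr rfl fun i _ => ?_
  rw [← Finset.sum_add_distrib, ← Finset.sum_add_distrib]
  refine Finset.sum_congr rfl fun j _ => ?_
  rcases lt_trichotomy i j with h | h | h
  · simp [h, h.ne, h.not_gt]
  · simp [h]
  · simp [h, h.ne', h.not_gt]

/-! ### Exponential moments of the quadratic form -/

section Bernoulli

variable {Ω : Type*} [MeasurableSpace Ω] {μ : Measure Ω}

theorem hasSubgaussianMGF_of_symmetric_bernoulli [IsProbabilityMeasure μ] {X : Ω → ℝ} (hX : Measurable X)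
    (h₁ : μ {ω | X ω = 1} = 1 / 2) (h₂ : μ {ω | X ω = -1} = 1 / 2) :
    HasSubgaussianMGF X 1 μ := by
  have hm₁ : MeasurableSet {ω | X ω = 1} := hX (measurableSet_singleton 1)
  have hm₂ : MeasurableSet {ω | X ω = -1} := hX (measurableSet_singleton (-1))
  have hdisj : Disjoint {ω | X ω = 1} {ω | X ω = -1} := by
    rw [Set.disjoint_left]
    intro ω h h'
    simp only [Set.mem_ofPred_eq] at h h'
    linarith
  have hae : ∀ᵐ ω ∂μ, ω ∈ {ω | X ω = 1} ∪ {ω | X ω = -1} := by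
    have h : μ ({ω | X ω = 1} ∪ {ω | X ω = -1}) = 1 := by
      rw [measure_union hdisj hm₂, h₁, h₂]
      simp [ENNReal.inv_two_add_inv_two]
    exact (mem_ae_iff_prob_eq_one (hm₁.union hm₂)).2 h
  have hmean : μ[X] = 0 := by
    have hX' : X =ᵐ[μ] fun ω => {ω | X ω = 1}.indicator (fun _ => (1 : ℝ)) ω
        + {ω | X ω = -1}.indicator (fun _ => (-1 : ℝ)) ω := by
      filter_upwards [hae] with ω hω
      rcases hω with h | h
      · have h' : ω ∉ {ω | X ω = -1} := Set.disjoint_left.1 hdisj h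
        rw [Set.indicator_of_mem h, Set.indicator_of_notMem h']
        simpa using h
      · have h' : ω ∉ {ω | X ω = 1} := Set.disjoint_right.1 hdisj h
        rw [Set.indicator_of_mem h, Set.indicator_of_notMem h']
        simpa using h
    rw [integral_congr_ae hX', integral_add ((integrable_const _).indicator hm₁)
      ((integrable_const _).indicator hm₂), integral_indicator_const _ hm₁,
      integral_indicator_const _ hm₂]
    simp [measureReal_def, h₁, h₂]
  have h := hasSubgaussianMGF_of_mem_Icc_of_integral_eq_zero (a := -1) (b := 1)
    hX.aemeasurable (by
      filter_upwards [hae] with ω hω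
      rcases hω with h | h <;> simp only [Set.mem_ofPred_eq] at h <;> rw [h] <;> norm_num) hmean
  convert h using 1
  ext
  norm_num

namespace IsSymmetricBernoulliMatrix

variable {k : ℕ} {A : Ω → Matrix (Fin k) (Fin k) ℝ}

theorem measurable_apply (hA : IsSymmetricBernoulliMatrix μ A) (i j : Fin k) :
    Measurable fun ω => A ω i j := by
  rcases lt_trichotomy i j with h | rfl | h
  · exact hA.measurable_entry i j h
  · simp [hA.diag_eq_zero]
  · simp_rw [fun ω => (hA.isSymm ω).apply j i]
    exact hA.measurable_entry j i h

/-- The form is a sum over i < j of independent sub-Gaussian terms with parameters (2uᵢuⱼ)². These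
total at most 2‖u‖⁴, and the factor 1/2 in the sub-Gaussian bound leaves b²‖u‖⁴. -/
theorem lintegral_exp_quadForm_le [IsProbabilityMeasure μ] (hA : IsSymmetricBernoulliMatrix μ A) (b : ℝ)
    (u : EuclideanSpace ℝ (Fin k)) :
    ∫⁻ ω, ENNReal.ofReal (exp (b * quadForm (A ω) u - b ^ 2 * ‖u‖ ^ 4)) ∂μ ≤ 1 := by
  let X : {p : Fin k × Fin k // p.1 < p.2} → Ω → ℝ :=
    fun p ω => 2 * (u p.1.1 * u p.1.2) * A ω p.1.1 p.1.2
  have hquad : ∀ ω, quadForm (A ω) u = ∑ p, X p ω := by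
    intro ω
    rw [quadForm, sum_sum_eq_diag_add_two_mul_upper]
    · simp only [hA.diag_eq_zero, zero_mul, Finset.sum_const_zero, zero_add, Finset.mul_sum, X]
      exact Finset.sum_congr rfl fun p _ => by ring
    · intro i j
      rw [(hA.isSymm ω).apply, mul_comm (u i)]
  have hnorm : ∑ p : {p : Fin k × Fin k // p.1 < p.2}, (2 * (u p.1.1 * u p.1.2)) ^ 2
      ≤ 2 * ‖u‖ ^ 4 := by
    have h₁ : ‖u‖ ^ 4 = ∑ i, ∑ j, u i ^ 2 * u j ^ 2 := by
      rw [← Finset.sum_mul_sum, ← EuclideanSpace.real_norm_sq_eq]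
      ring
    rw [h₁, sum_sum_eq_diag_add_two_mul_upper _ fun i j => mul_comm _ _]
    have h₂ : 0 ≤ ∑ i, u i ^ 2 * u i ^ 2 := Finset.sum_nonneg fun i _ => by positivity
    have h₃ : ∑ p : {p : Fin k × Fin k // p.1 < p.2}, (2 * (u p.1.1 * u p.1.2)) ^ 2
        = 4 * ∑ p : {p : Fin k × Fin k // p.1 < p.2}, u p.1.1 ^ 2 * u p.1.2 ^ 2 := by
      rw [Finset.mul_sum]
      exact Finset.sum_congr rfl fun p _ => by ring
    rw [h₃]
    linarith
  have hindep : iIndepFun X μ :=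
    hA.indep.comp (fun p x => 2 * (u p.1.1 * u p.1.2) * x) fun p => measurable_const_mul _
  have hX : ∀ p, HasSubgaussianMGF (X p) (toNNReal ((2 * (u p.1.1 * u p.1.2)) ^ 2)) μ := by
    intro p
    have h := (hasSubgaussianMGF_of_symmetric_bernoulli (hA.measurable_entry _ _ p.2)
      (hA.prob_one _ _ p.2) (hA.prob_neg_one _ _ p.2)).const_mul (2 * (u p.1.1 * u p.1.2))
    convert h using 1
    exact (Real.toNNReal_of_nonneg (sq_nonneg _)).trans (mul_one _).symm
  have hsub := HasSubgaussianMGF.sum_of_iIndepFun hindep (s := Finset.univ) fun p _ => hX p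
  have hmgf := hsub.mgf_le b
  have hint := hsub.integrable_exp_mul b
  rw [← ofReal_integral_eq_lintegral_ofReal, ENNReal.ofReal_le_one]
  · simp_rw [hquad, sub_eq_add_neg, exp_add]
    rw [integral_mul_const]
    refine (mul_le_mul_of_nonneg_right hmgf (exp_pos _).le).trans ?_
    rw [← exp_add, exp_le_one_iff]
    push_cast
    simp_rw [Real.coe_toNNReal _ (sq_nonneg _)]
    nlinarith [mul_le_mul_of_nonneg_right hnorm (sq_nonneg b)]
  · simp_rw [hquad, sub_eq_add_neg, exp_add]
    exact hint.mul_const _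
  · exact Filter.Eventually.of_forall fun ω => (exp_pos _).le

end IsSymmetricBernoulliMatrix

end Bernoulli

/-! ### Averages over Euclidean balls -/

section Ball

variable {k : ℕ}

theorem continuous_quadForm (A : Matrix (Fin k) (Fin k) ℝ) : Continuous (quadForm A) := by
  unfold quadForm
  fun_prop

/-- A linear isometry preserves volume and centred balls. It is used below for x ↦ -x and for the
sign flip of one coordinate. -/
theorem setIntegral_closedBall_eq_zero_of_odd {E : Type*} [NormedAddCommGroup E]
    [InnerProductSpace ℝ E] [FiniteDimensional ℝ E] [MeasurableSpace E] [BorelSpace E]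
    (L : E ≃ₗᵢ[ℝ] E) {f : E → ℝ} (hf : ∀ x, f (L x) = -f x) (r : ℝ) :
    ∫ x in closedBall (0 : E) r, f x = 0 := by
  have h := L.measurePreserving.setIntegral_preimage_emb
    L.toHomeomorph.measurableEmbedding f (closedBall 0 r)
  rw [L.preimage_closedBall, map_zero] at h
  simp_rw [hf, integral_neg] at h
  linarith

theorem setIntegral_closedBall_inner_eq_zero (v : EuclideanSpace ℝ (Fin k)) (r : ℝ) :
    ∫ x in closedBall (0 : EuclideanSpace ℝ (Fin k)) r, inner ℝ v x = 0 :=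
  setIntegral_closedBall_eq_zero_of_odd (LinearIsometryEquiv.neg ℝ) (by simp) r

theorem setIntegral_closedBall_mul_eq_zero {i j : Fin k} (hij : i ≠ j) (r : ℝ) :
    ∫ x in closedBall (0 : EuclideanSpace ℝ (Fin k)) r, x i * x j = 0 := by
  refine setIntegral_closedBall_eq_zero_of_odd (LinearIsometryEquiv.piLpCongrRight 2
    fun l => if l = i then LinearIsometryEquiv.neg ℝ else LinearIsometryEquiv.refl ℝ ℝ) ?_ r
  intro x
  simp [LinearIsometryEquiv.piLpCongrRight_apply, hij.symm]

theorem Continuous.integrableOn_euclidean_closedBall {f : EuclideanSpace ℝ (Fin k) → ℝ}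
    (hf : Continuous f) (x : EuclideanSpace ℝ (Fin k)) (r : ℝ) :
    IntegrableOn f (closedBall x r) :=
  hf.continuousOn.integrableOn_compact (isCompact_closedBall x r)

theorem setIntegral_closedBall_quadForm_eq_zero {A : Matrix (Fin k) (Fin k) ℝ}
    (hA : ∀ i, A i i = 0) (r : ℝ) :
    ∫ x in closedBall (0 : EuclideanSpace ℝ (Fin k)) r, quadForm A x = 0 := by
  unfold quadForm
  rw [integral_finsetSum]
  · refine Finset.sum_eq_zero fun i _ => ?_
    rw [integral_finsetSum]
    · refine Finset.sum_eq_zero fun j _ => ?_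
      rw [integral_const_mul]
      rcases eq_or_ne i j with rfl | hij
      · rw [hA, zero_mul]
      · rw [setIntegral_closedBall_mul_eq_zero hij, mul_zero]
    · exact fun j _ => Continuous.integrableOn_euclidean_closedBall (by fun_prop) 0 r
  · exact fun i _ => Continuous.integrableOn_euclidean_closedBall (by fun_prop) 0 r

theorem quadForm_smul_add {A : Matrix (Fin k) (Fin k) ℝ} (hA : A.IsSymm)
    {v : EuclideanSpace ℝ (Fin k)} {l : ℝ} (hv : A.mulVec v = l • ⇑v) (hv1 : ‖v‖ = 1)
    (a : ℝ) (x : EuclideanSpace ℝ (Fin k)) :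
    quadForm A (a • v + x) = a ^ 2 * l + 2 * a * l * inner ℝ v x + quadForm A x := by
  have hrow : ∀ i, ∑ j, A i j * v j = l * v i := fun i => congrFun hv i
  have hcol : ∀ j, ∑ i, A i j * v i = l * v j := fun j => by
    rw [← hrow j]
    exact Finset.sum_congr rfl fun i _ => by rw [hA.apply]
  have hinner : inner ℝ v x = ∑ i, v i * x i := by
    simp [PiLp.inner_apply, mul_comm]
  have hnorm : ∑ i, v i * v i = 1 := by
    have h := EuclideanSpace.real_norm_sq_eq v
    rw [hv1] at h
    simp_rw [← pow_two, ← h, one_pow]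
  have h₁ : ∑ i, ∑ j, A i j * (v i * v j) = l := by
    have : ∀ i, ∑ j, A i j * (v i * v j) = l * (v i * v i) := fun i => by
      rw [← mul_assoc, ← hrow, Finset.sum_mul]
      exact Finset.sum_congr rfl fun j _ => by ring
    simp_rw [this, ← Finset.mul_sum, hnorm, mul_one]
  have h₂ : ∑ i, ∑ j, A i j * (x i * v j) = l * inner ℝ v x := by
    rw [hinner, Finset.mul_sum]
    refine Finset.sum_congr rfl fun i _ => ?_
    rw [← mul_assoc, ← hrow, Finset.sum_mul]
    exact Finset.sum_congr rfl fun j _ => by ring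
  have h₃ : ∑ i, ∑ j, A i j * (v i * x j) = l * inner ℝ v x := by
    rw [hinner, Finset.mul_sum, Finset.sum_comm]
    refine Finset.sum_congr rfl fun i _ => ?_
    rw [← mul_assoc, ← hcol, Finset.sum_mul]
    exact Finset.sum_congr rfl fun j _ => by ring
  have hexp : quadForm A (a • v + x) = a ^ 2 * ∑ i, ∑ j, A i j * (v i * v j)
      + a * ∑ i, ∑ j, A i j * (v i * x j) + a * ∑ i, ∑ j, A i j * (x i * v j)
      + quadForm A x := by
    simp only [quadForm, Finset.mul_sum, ← Finset.sum_add_distrib]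
    refine Finset.sum_congr rfl fun i _ => Finset.sum_congr rfl fun j _ => ?_
    simp only [PiLp.add_apply, PiLp.smul_apply, smul_eq_mul]
    ring
  rw [hexp, h₁, h₂, h₃]
  ring

/-- Since a² + r² = 1, ‖av + x‖² ≤ 1 + 2a⟨v, x⟩. Squaring leaves a linear term, kept because it
averages to 0, and a square bounded by Cauchy–Schwarz. -/
theorem norm_smul_add_pow_four_le {E : Type*} [NormedAddCommGroup E] [InnerProductSpace ℝ E]
    {v x : E} {a r : ℝ} (hv : ‖v‖ = 1) (hx : ‖x‖ ≤ r) (har : a ^ 2 + r ^ 2 = 1) :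
    ‖a • v + x‖ ^ 4 ≤ 1 + 4 * a ^ 2 * r ^ 2 + 4 * a * inner ℝ v x := by
  have hexp : ‖a • v + x‖ ^ 2 = a ^ 2 + 2 * a * inner ℝ v x + ‖x‖ ^ 2 := by
    rw [norm_add_sq_real, norm_smul, hv, inner_smul_left]
    simp
    ring
  have hx2 : ‖x‖ ^ 2 ≤ r ^ 2 := pow_le_pow_left₀ (norm_nonneg _) hx 2
  have hle : ‖a • v + x‖ ^ 2 ≤ 1 + 2 * a * inner ℝ v x := by linarith
  have hin : (inner ℝ v x) ^ 2 ≤ r ^ 2 := by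
    have h := abs_real_inner_le_norm v x
    rw [hv, one_mul] at h
    exact (sq_le_sq.2 (h.trans (le_abs_self _))).trans hx2
  calc ‖a • v + x‖ ^ 4 = (‖a • v + x‖ ^ 2) ^ 2 := by ring
    _ ≤ (1 + 2 * a * inner ℝ v x) ^ 2 := pow_le_pow_left₀ (by positivity) hle 2
    _ ≤ _ := by nlinarith [mul_le_mul_of_nonneg_left hin (sq_nonneg a)]

/-- Jensen's inequality on a ball, for an eigenvector `v` of a matrix with zero diagonal. -/
theorem exp_mul_volume_le_lintegral_exp_quadForm {A : Matrix (Fin k) (Fin k) ℝ} (hA : A.IsSymm)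
    (hdiag : ∀ i, A i i = 0) {v : EuclideanSpace ℝ (Fin k)} {l : ℝ}
    (hv : A.mulVec v = l • ⇑v) (hv1 : ‖v‖ = 1) (b : ℝ) {a r : ℝ} (ha : 0 ≤ a)
    (har : a ^ 2 + r ^ 2 = 1) :
    ENNReal.ofReal (exp (b * (a ^ 2 * l) - b ^ 2 * (1 + 4 * a ^ 2 * r ^ 2)))
        * volume (closedBall (0 : EuclideanSpace ℝ (Fin k)) r)
      ≤ ∫⁻ u in closedBall (0 : EuclideanSpace ℝ (Fin k)) (a + r),
          ENNReal.ofReal (exp (b * quadForm A u - b ^ 2 * ‖u‖ ^ 4)) := by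
  set c := b * (a ^ 2 * l) - b ^ 2 * (1 + 4 * a ^ 2 * r ^ 2) with hc
  -- The total coefficient of ⟨v, x⟩; its value is immaterial, since this term integrates to 0.
  set d := 2 * a * (b * l) - 4 * a * b ^ 2 with hd
  let f : EuclideanSpace ℝ (Fin k) → ℝ := fun u => exp (b * quadForm A u - b ^ 2 * ‖u‖ ^ 4)
  have hf : Continuous f := by
    have := continuous_quadForm A
    fun_prop
  -- Jensen in the form of the tangent line bound eʸ ≥ 1 + y.
  have hpoint : ∀ x ∈ closedBall (0 : EuclideanSpace ℝ (Fin k)) r,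
      exp c * (1 + (d * inner ℝ v x + b * quadForm A x)) ≤ f (x + a • v) := by
    intro x hx
    rw [mem_closedBall_zero_iff] at hx
    have h₁ := quadForm_smul_add hA hv hv1 a x
    have h₂ := norm_smul_add_pow_four_le hv1 hx har
    have h₃ : c + (d * inner ℝ v x + b * quadForm A x)
        ≤ b * quadForm A (x + a • v) - b ^ 2 * ‖x + a • v‖ ^ 4 := by
      rw [add_comm x, h₁]
      have h₄ := mul_le_mul_of_nonneg_left h₂ (sq_nonneg b)
      rw [hc, hd]
      linarith
    refine le_trans ?_ (exp_le_exp.2 h₃)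
    rw [exp_add]
    refine mul_le_mul_of_nonneg_left ?_ (exp_pos c).le
    linarith [add_one_le_exp (d * inner ℝ v x + b * quadForm A x)]
  have hshift : Continuous fun x : EuclideanSpace ℝ (Fin k) => f (x + a • v) := by fun_prop
  have hfin : volume (closedBall (0 : EuclideanSpace ℝ (Fin k)) r) ≠ ⊤ :=
    (isCompact_closedBall _ _).measure_ne_top
  have hi₁ : IntegrableOn (fun x : EuclideanSpace ℝ (Fin k) => d * inner ℝ v x)
      (closedBall 0 r) := Continuous.integrableOn_euclidean_closedBall (by fun_prop) 0 r
  have hi₂ : IntegrableOn (fun x : EuclideanSpace ℝ (Fin k) => b * quadForm A x)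
      (closedBall 0 r) := Continuous.integrableOn_euclidean_closedBall
        ((continuous_quadForm A).const_mul b) 0 r
  have hi₃ : IntegrableOn (fun _ : EuclideanSpace ℝ (Fin k) => (1 : ℝ)) (closedBall 0 r) :=
    Continuous.integrableOn_euclidean_closedBall (by fun_prop) 0 r
  have hlower : exp c * volume.real (closedBall (0 : EuclideanSpace ℝ (Fin k)) r)
      ≤ ∫ x in closedBall (0 : EuclideanSpace ℝ (Fin k)) r, f (x + a • v) := by
    have h := setIntegral_mono_on ((hi₃.add (hi₁.add hi₂)).const_mul (exp c))
      (hshift.integrableOn_euclidean_closedBall 0 r) measurableSet_closedBall hpoint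
    refine le_trans (le_of_eq ?_) h
    rw [integral_const_mul, integral_add' hi₃ (hi₁.add hi₂), integral_add' hi₁ hi₂,
      integral_const_mul, integral_const_mul, setIntegral_closedBall_inner_eq_zero,
      setIntegral_closedBall_quadForm_eq_zero hdiag]
    simp
  have htrans : ∫⁻ x in closedBall (0 : EuclideanSpace ℝ (Fin k)) r,
      ENNReal.ofReal (f (x + a • v)) ≤ ∫⁻ u in closedBall (0 : EuclideanSpace ℝ (Fin k)) (a + r),
        ENNReal.ofReal (f u) := by
    have h := (measurePreserving_add_right volume (a • v)).setLIntegral_comp_emb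
      (measurableEmbedding_addRight (a • v)) (fun u => ENNReal.ofReal (f u)) (closedBall 0 r)
    refine h.le.trans (lintegral_mono_set ?_)
    rintro _ ⟨x, hx, rfl⟩
    rw [mem_closedBall_zero_iff] at hx ⊢
    refine (norm_add_le _ _).trans ?_
    rw [norm_smul, hv1, Real.norm_of_nonneg ha]
    linarith
  refine le_trans ?_ htrans
  rw [← ofReal_integral_eq_lintegral_ofReal (hshift.integrableOn_euclidean_closedBall 0 r)
    (Filter.Eventually.of_forall fun x => (exp_pos _).le)]
  refine le_trans (le_of_eq ?_) (ENNReal.ofReal_le_ofReal hlower)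
  rw [ENNReal.ofReal_mul (exp_pos c).le, measureReal_def, ENNReal.ofReal_toReal hfin]

end Ball

/-! ### Markov's inequality for the partition function -/

theorem IsSymmetricBernoulliMatrix.measurable_exp_quadForm {Ω : Type*} [MeasurableSpace Ω]
    {μ : Measure Ω} {k : ℕ} {A : Ω → Matrix (Fin k) (Fin k) ℝ}
    (hA : IsSymmetricBernoulliMatrix μ A) (b : ℝ) :
    Measurable fun p : Ω × EuclideanSpace ℝ (Fin k) =>
      ENNReal.ofReal (exp (b * quadForm (A p.1) p.2 - b ^ 2 * ‖p.2‖ ^ 4)) := by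
  have hcoord : ∀ i : Fin k, Measurable fun p : Ω × EuclideanSpace ℝ (Fin k) => p.2 i := by
    intro i
    have : Continuous fun u : EuclideanSpace ℝ (Fin k) => u i := by fun_prop
    exact this.measurable.comp measurable_snd
  have hquad : Measurable fun p : Ω × EuclideanSpace ℝ (Fin k) => quadForm (A p.1) p.2 := by
    unfold quadForm
    exact Finset.measurable_sum _ fun i _ => Finset.measurable_sum _ fun j _ =>
      ((hA.measurable_apply i j).comp measurable_fst).mul ((hcoord i).mul (hcoord j))
  fun_prop

/-- First moment bound: a large eigenvalue forces the partition function
`∫ exp (b * quadForm A u - b ^ 2 * ‖u‖ ^ 4)` over a ball to be large. -/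
theorem IsSymmetricBernoulliMatrix.measure_exists_eigenvalue_le {Ω : Type*} [MeasurableSpace Ω]
    {μ : Measure Ω} [IsProbabilityMeasure μ] {k : ℕ} {A : Ω → Matrix (Fin k) (Fin k) ℝ}
    (hA : IsSymmetricBernoulliMatrix μ A) {a r : ℝ} (ha : 0 ≤ a) (hr : 0 < r)
    (har : a ^ 2 + r ^ 2 = 1) (b z : ℝ) :
    μ.real {ω | ∃ i, z ≤ b * (hA.isHermitian ω).eigenvalues i}
      ≤ ((a + r) / r) ^ k * exp (b ^ 2 * (1 + 4 * a ^ 2 * r ^ 2) - a ^ 2 * z) := by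
  set V := volume (closedBall (0 : EuclideanSpace ℝ (Fin k)) 1) with hV
  have hV0 : V ≠ 0 := (measure_closedBall_pos volume 0 one_pos).ne'
  have hVtop : V ≠ ⊤ := (isCompact_closedBall _ _).measure_ne_top
  set c := a ^ 2 * z - b ^ 2 * (1 + 4 * a ^ 2 * r ^ 2) with hc
  let Z : Ω → ENNReal := fun ω => ∫⁻ u in closedBall (0 : EuclideanSpace ℝ (Fin k)) (a + r),
    ENNReal.ofReal (exp (b * quadForm (A ω) u - b ^ 2 * ‖u‖ ^ 4))
  have hvol : ∀ s : ℝ, 0 ≤ s → volume (closedBall (0 : EuclideanSpace ℝ (Fin k)) s)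
      = ENNReal.ofReal (s ^ k) * V := by
    intro s hs
    rw [Measure.addHaar_closedBall' _ _ hs, finrank_euclideanSpace_fin]
  have hmeas := hA.measurable_exp_quadForm b
  have hupper : ∫⁻ ω, Z ω ∂μ ≤ ENNReal.ofReal ((a + r) ^ k) * V := by
    rw [lintegral_lintegral_swap hmeas.aemeasurable, ← hvol _ (by positivity)]
    calc _ ≤ ∫⁻ _ in closedBall (0 : EuclideanSpace ℝ (Fin k)) (a + r), 1 :=
          lintegral_mono fun u => hA.lintegral_exp_quadForm_le b u
      _ = _ := by simp
  have hsub : {ω | ∃ i, z ≤ b * (hA.isHermitian ω).eigenvalues i}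
      ⊆ {ω | ENNReal.ofReal (exp c) * (ENNReal.ofReal (r ^ k) * V) ≤ Z ω} := by
    rintro ω ⟨i, hi⟩
    have h := exp_mul_volume_le_lintegral_exp_quadForm (hA.isSymm ω) (hA.diag_eq_zero ω)
      ((hA.isHermitian ω).mulVec_eigenvectorBasis i)
      ((hA.isHermitian ω).eigenvectorBasis.orthonormal.1 i) b ha har
    rw [hvol r hr.le] at h
    refine le_trans (mul_le_mul_left (ENNReal.ofReal_le_ofReal (exp_le_exp.2 ?_)) _) h
    have := mul_le_mul_of_nonneg_left hi (sq_nonneg a)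
    rw [hc]
    linarith
  have hmarkov := (mul_le_mul_right (measure_mono hsub) _).trans
    ((mul_meas_ge_le_lintegral hmeas.lintegral_prod_right'
      (ENNReal.ofReal (exp c) * (ENNReal.ofReal (r ^ k) * V))).trans hupper)
  have hreal := ENNReal.toReal_mono (ENNReal.mul_ne_top ENNReal.ofReal_ne_top hVtop) hmarkov
  simp only [ENNReal.toReal_mul, ENNReal.toReal_ofReal (exp_pos c).le,
    ENNReal.toReal_ofReal (pow_nonneg hr.le k),
    ENNReal.toReal_ofReal (pow_nonneg (add_nonneg ha hr.le) k)] at hreal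
  have hVpos : 0 < V.toReal := ENNReal.toReal_pos hV0 hVtop
  have hrk : 0 < r ^ k := pow_pos hr k
  have hbound : exp c * r ^ k * μ.real {ω | ∃ i, z ≤ b * (hA.isHermitian ω).eigenvalues i}
      ≤ (a + r) ^ k := by
    refine le_of_mul_le_mul_right (le_trans (le_of_eq ?_) hreal) hVpos
    rw [measureReal_def]
    ring
  have hexp : exp (b ^ 2 * (1 + 4 * a ^ 2 * r ^ 2) - a ^ 2 * z) = (exp c)⁻¹ := by
    rw [← exp_neg, hc, neg_sub]
  rw [hexp, div_pow, ← div_eq_mul_inv, div_div, le_div_iff₀ (by positivity)]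
  linarith

/-- Here 49/9 is (a + r)/r for the chosen radii, and 171/100 = 9 · 19/100 is the gain per dimension
from y² ≥ 9k. -/
theorem fortynine_ninths_le_exp : (49 / 9 : ℝ) ≤ exp (171 / 100) := by
  have h₁ : (271828 / 100000 : ℝ) ≤ exp 1 := by
    have := exp_one_gt_d9
    norm_num at this ⊢
    linarith
  have h₂ : (203 / 100 : ℝ) ≤ exp (71 / 100) := by
    have h := sum_le_exp_of_nonneg (x := 71 / 100) (by norm_num) 5
    norm_num [Finset.sum_range_succ, Nat.factorial] at h ⊢
    linarith
  rw [show (171 / 100 : ℝ) = 1 + 71 / 100 by norm_num, exp_add]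
  refine le_trans ?_ (mul_le_mul h₁ h₂ (by norm_num) (exp_pos 1).le)
  norm_num

theorem IsSymmetricBernoulliMatrix.measure_exists_eigenvalue_ge_le {Ω : Type*}
    [MeasurableSpace Ω] {μ : Measure Ω} [IsProbabilityMeasure μ] {k : ℕ}
    {A : Ω → Matrix (Fin k) (Fin k) ℝ} (hA : IsSymmetricBernoulliMatrix μ A) {s t : ℝ}
    (hs : s ^ 2 = 1) (ht : 0 ≤ t) :
    μ.real {ω | ∃ i, 3 * √k + t ≤ s * (hA.isHermitian ω).eigenvalues i}
      ≤ exp (-t ^ 2 / 32) := by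
  set y := 3 * √(k : ℝ) + t with hy
  have hy0 : 0 ≤ y := by positivity
  have hy2 : 9 * k + t ^ 2 ≤ y ^ 2 := by
    have h₁ : √(k : ℝ) ^ 2 = k := sq_sqrt (Nat.cast_nonneg k)
    have h₂ : 0 ≤ √(k : ℝ) * t := by positivity
    rw [hy]
    nlinarith
  set κ : ℝ := 1 + 4 * (40 / 41) ^ 2 * (9 / 41) ^ 2 with hκ
  -- The minimiser of b²κ - a²by, with minimum -a⁴y²/(4κ).
  set b := (40 / 41) ^ 2 * y / (2 * κ) with hb
  have hb0 : 0 ≤ b := by positivity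
  -- The triple 9² + 40² = 41² gives rational radii. The sign s goes into b, which elsewhere enters
  -- only as b².
  have h := hA.measure_exists_eigenvalue_le (a := 40 / 41) (r := 9 / 41) (by norm_num)
    (by norm_num) (by norm_num) (b * s) (b * y)
  have hsub : {ω | ∃ i, y ≤ s * (hA.isHermitian ω).eigenvalues i}
      ⊆ {ω | ∃ i, b * y ≤ b * s * (hA.isHermitian ω).eigenvalues i} := by
    rintro ω ⟨i, hi⟩
    exact ⟨i, by rw [mul_assoc]; exact mul_le_mul_of_nonneg_left hi hb0⟩
  refine (measureReal_mono hsub).trans (h.trans ?_)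
  have hk : (((40 / 41 : ℝ) + 9 / 41) / (9 / 41)) ^ k ≤ exp (k * (171 / 100)) := by
    rw [exp_nat_mul]
    refine pow_le_pow_left₀ (by norm_num) (le_trans (le_of_eq ?_) fortynine_ninths_le_exp) k
    norm_num
  refine (mul_le_mul_of_nonneg_right hk (exp_pos _).le).trans ?_
  rw [← exp_add, exp_le_exp, mul_pow, hs, mul_one, ← hκ]
  have hexp : b ^ 2 * κ - (40 / 41) ^ 2 * (b * y) ≤ -(19 / 100) * y ^ 2 := by
    have heq : b ^ 2 * κ - (40 / 41) ^ 2 * (b * y) = -((40 / 41) ^ 4 / (4 * κ)) * y ^ 2 := by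
      rw [hb]
      have : κ ≠ 0 := by positivity
      field_simp
      ring
    rw [heq]
    refine mul_le_mul_of_nonneg_right ?_ (sq_nonneg y)
    rw [hκ]
    norm_num
  -- The 171k/100 terms cancel, leaving -19t²/100 ≤ -t²/32.
  nlinarith [sq_nonneg t]

theorem mainTheorem8 :
    ∃ k₀ : ℕ, ∀ k : ℕ, k₀ ≤ k →
      ∀ (Ω : Type*) [MeasurableSpace Ω] (μ : MeasureTheory.Measure Ω)
        [MeasureTheory.IsProbabilityMeasure μ] (A : Ω → Matrix (Fin k) (Fin k) ℝ)
        (hA : IsSymmetricBernoulliMatrix μ A) (t : ℝ), 0 ≤ t →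
        μ.real {ω | 3 * Real.sqrt k + t ≤ ⨆ i : Fin k, |(hA.isHermitian ω).eigenvalues i|}
          ≤ 4 * Real.exp (-t ^ 2 / 32) := by
  -- k ≥ 1 serves only to make the index set nonempty, so that the supremum is attained.
  refine ⟨1, fun k hk Ω _ μ _ A hA t ht => ?_⟩
  have : Nonempty (Fin k) := ⟨⟨0, hk⟩⟩
  have hsub : {ω | 3 * √k + t ≤ ⨆ i : Fin k, |(hA.isHermitian ω).eigenvalues i|}
      ⊆ {ω | ∃ i, 3 * √k + t ≤ 1 * (hA.isHermitian ω).eigenvalues i}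
        ∪ {ω | ∃ i, 3 * √k + t ≤ -1 * (hA.isHermitian ω).eigenvalues i} := by
    intro ω hω
    obtain ⟨i, hi⟩ := exists_eq_ciSup_of_finite
      (f := fun i : Fin k => |(hA.isHermitian ω).eigenvalues i|)
    have hω' : 3 * √k + t ≤ |(hA.isHermitian ω).eigenvalues i| := hω.trans_eq hi.symm
    rcases le_abs.1 hω' with h | h
    · exact Or.inl ⟨i, by rwa [one_mul]⟩
    · exact Or.inr ⟨i, by rwa [neg_one_mul]⟩
  have h₁ := hA.measure_exists_eigenvalue_ge_le (s := 1) (by norm_num) ht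
  have h₂ := hA.measure_exists_eigenvalue_ge_le (s := -1) (by norm_num) ht
  have h₃ := (measureReal_mono (μ := μ) hsub).trans (measureReal_union_le _ _)
  linarith [exp_pos (-t ^ 2 / 32)]
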